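/- Let $n=k_1+\cdots+k_m$ with $m\ge 1$ and positive integers $k_1,\dots,k_m$. For integers $p,q\ge 0$ let $B(p,q)$ be the open matrix ball of all complex $p\times q$ matrices $X$ such that $I_q-X^*X$ is positive definite, and for $X\in B(p,q)$ put $$W(X)=\begin{pmatrix}(I_p-XX^*)^{1/2} & X\\ -X^* & (I_q-X^*X)^{1/2}\end{pmatrix}.$$ Identify $U(k_1)\times\cdots\times U(k_m)$ with the group of block diagonal matrices $\mathrm{diag}(V_1,\dots,V_m)$, $V_j\in U(k_j)$, in $U(n)$. A subset $A$ of $U(n)$, regarded as a smooth real manifold of dimension $n^2$ (an embedded submanifold of the space of complex $n\times n$ matrices), has measure zero if $\varphi(A\cap\Omega)$ is a Lebesgue null set in $\mathbb R^{n^2}$ for every smooth chart $(\Omega,\varphi)$ of $U(n)$. Theorem. For all $g\in U(n)$ outside a set of measure zero there are a unique tuple $$(X_m,X_{m-1},\dots,X_2)\in B(n-k_m,k_m)\times B(n-k_{m-1}-k_m,k_{m-1})\times\cdots\times B(n-k_2-\cdots-k_m,k_2)$$ (so $X_j\in B(k_1+\cdots+k_{j-1},k_j)$ for $2\le j\le m$)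 and a unique $h\in U(k_1)\times\cdots\times U(k_m)$ such that $$g=W(X_m)\begin{pmatrix}W(X_{m-1})&0\\0&I_{k_m}\end{pmatrix}\cdots\begin{pmatrix}W(X_2)&0\\0&I_{k_3+\cdots+k_m}\end{pmatrix}h .$$ That is, exactly one pair $\big((X_m,\dots,X_2),h\big)$ satisfies this identity. -/

import Mathlib

open scoped ContDiff ComplexOrder MatrixOrder

noncomputable section

/-- A smooth local coordinate system of the unitary group `U(n)`, viewed as an embedded real
submanifold of dimension `n ^ 2` of the space of complex `n × n` matrices: a homeomorphism `φ` from
an open subset of `U(n)` onto an open subset of `ℝ ^ (n ^ 2)` whose inverse is a smooth immersion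
into the space of matrices. -/
def IsUnitaryChart (n : ℕ)
    (φ : OpenPartialHomeomorph (Matrix.unitaryGroup (Fin n) ℂ) (EuclideanSpace ℝ (Fin (n ^ 2)))) :
    Prop :=
  ContDiffOn ℝ ∞ (fun (x : EuclideanSpace ℝ (Fin (n ^ 2))) (a b : Fin n) => (φ.symm x).1 a b)
      φ.target ∧
    ∀ x ∈ φ.target, Function.Injective
      (fderiv ℝ (fun (x : EuclideanSpace ℝ (Fin (n ^ 2))) (a b : Fin n) => (φ.symm x).1 a b) x)

/-- A subset of the manifold `U(n)` has measure zero if its image in every smooth local coordinate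
system is a Lebesgue null set. -/
def IsMeasureZero {n : ℕ} (A : Set (Matrix.unitaryGroup (Fin n) ℂ)) : Prop :=
  ∀ φ : OpenPartialHomeomorph (Matrix.unitaryGroup (Fin n) ℂ) (EuclideanSpace ℝ (Fin (n ^ 2))),
    IsUnitaryChart n φ → MeasureTheory.volume (φ '' (A ∩ φ.source)) = 0

/-- The open matrix ball `B(p, q)` of complex `p × q` matrices `X` with `Xᴴ * X < I`, i.e. with
`I - Xᴴ * X` positive definite. -/
def matrixBall (p q : Type) [Fintype p] [Fintype q] [DecidableEq q] : Set (Matrix p q ℂ) :=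
  {X | (1 - X.conjTranspose * X).PosDef}

/-- The matrix `W(X)` with blocks `(I - X * Xᴴ) ^ (1/2)`, `X`, `-Xᴴ`, `(I - Xᴴ * X) ^ (1/2)`. -/
def blockW {p q : Type} [Fintype p] [Fintype q] [DecidableEq p] [DecidableEq q]
    (X : Matrix p q ℂ) : Matrix (p ⊕ q) (p ⊕ q) ℂ :=
  Matrix.fromBlocks (CFC.sqrt (1 - X * X.conjTranspose)) X
    (-X.conjTranspose) (CFC.sqrt (1 - X.conjTranspose * X))

/-- Indices of `n × n` matrices, `n = ∑ j, k j`, partitioned into consecutive blocks of sizes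
`k 0, k 1, …`: the pair `⟨j, a⟩` is the `a`-th index of the `j`-th block. -/
abbrev BlockIndex {m : ℕ} (k : Fin m → ℕ) : Type := (j : Fin m) × Fin (k j)

/-- The numbering of the block indices by `0, …, n - 1`, the blocks following one another:
`⟨j, a⟩` has number `k 0 + … + k (j - 1) + a`. -/
def blockNumbering {n m : ℕ} (k : Fin m → ℕ) (hn : ∑ j, k j = n) : BlockIndex k ≃ Fin n :=
  finSigmaFinEquiv.trans (finCongr hn)

/-- The indices in the blocks before the `j`-th one; there are `k 0 + … + k (j - 1)` of them. -/
abbrev BlocksBefore {m : ℕ} (k : Fin m → ℕ) (j : Fin m) : Type := {p : BlockIndex k // p.1 < j}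

/-- The indices in the blocks after the `j`-th one. -/
abbrev BlocksAfter {m : ℕ} (k : Fin m → ℕ) (j : Fin m) : Type := {p : BlockIndex k // j < p.1}

/-- Splitting all indices into those before, in, and after the `j`-th block. -/
def blockSplit {m : ℕ} (k : Fin m → ℕ) (j : Fin m) :
    (BlocksBefore k j ⊕ Fin (k j)) ⊕ BlocksAfter k j ≃ BlockIndex k where
  toFun := Sum.elim (Sum.elim Subtype.val (fun a => ⟨j, a⟩)) Subtype.val
  invFun p :=
    if h : p.1 < j then Sum.inl (Sum.inl ⟨p, h⟩)
    else if h' : j < p.1 then Sum.inr ⟨p, h'⟩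
    else Sum.inl (Sum.inr (Fin.cast (congrArg k (le_antisymm (not_lt.1 h') (not_lt.1 h))) p.2))
  left_inv := by
    rintro ((⟨p, hp⟩ | a) | ⟨p, hp⟩)
    · simp [hp]
    · simp
    · simp [hp, hp.le]
  right_inv := by
    rintro ⟨i, a⟩
    rcases lt_trichotomy i j with h | h | h
    · simp [h]
    · subst h; simp
    · simp [h, h.not_gt]

/-- The block diagonal matrix `diag (W(X), I)`, where `W(X)` occupies the blocks `0, …, j` and the
identity matrix occupies the blocks after the `j`-th one. -/
def extendedW {m : ℕ} (k : Fin m → ℕ) (j : Fin m) (X : Matrix (BlocksBefore k j) (Fin (k j)) ℂ) :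
    Matrix (BlockIndex k) (BlockIndex k) ℂ :=
  Matrix.reindex (blockSplit k j) (blockSplit k j) (Matrix.fromBlocks (blockW X) 0 0 1)

/-- The parameter space: one open matrix ball for every block except the first one. -/
abbrev BallParameters {m : ℕ} (k : Fin (m + 1) → ℕ) : Type :=
  (j : Fin m) → matrixBall (BlocksBefore k j.succ) (Fin (k j.succ))

/-- The ordered product of the matrices `diag (W(X j), I)`, the last block being leftmost. -/
def cosetProduct {m : ℕ} (k : Fin (m + 1) → ℕ) (X : BallParameters k) :
    Matrix (BlockIndex k) (BlockIndex k) ℂ :=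
  (List.ofFn fun j : Fin m => extendedW k j.succ (X j).1).reverse.prod

end

open Matrix

/-! ### The matrix ball and the unitary matrix W(X). -/

section Ball

variable {p q : Type} [Fintype p] [Fintype q] [DecidableEq q]

/-! The factorization is block Gaussian elimination by unitary steps. Suppose block column j has
upper part u and invertible diagonal block d, and put Z = u d⁻¹. Then X = Z (I + Zᴴ Z)^(-1/2) lies
in the ball and W(X)ᴴ annihilates u. Eliminating from the last block down to the second never
disturbs the columns already cleared, and it ends in a block lower triangular unitary matrix, which
must be block diagonal: this is h. Conversely, the same elimination applied to a product of the
required form returns its factors (`columnResidual_cosetProduct_mul`), which gives uniqueness.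

All of this works when every diagonal block met is invertible (`BlockNondegenerate`). The
exceptional set is first shown to be null in the space of all matrices: with the later columns
fixed, the block in question is an affine function of its own column with surjective linear part
(`ae_det_columnResidual_ne_zero`). Degeneracy persists under right multiplication by lower
triangular matrices (`blockNondegenerate_of_mul`). Near U(n), unitary matrices times lower
triangular ones with real diagonal fill an open set of matrices, so Fubini transfers nullity to
charts of U(n) (`isMeasureZero_of_volume_eq_zero`). -/

theorem Matrix.PosDef.cfcSqrt {A : Matrix q q ℂ} (hA : A.PosDef) : (CFC.sqrt A).PosDef :=
  Matrix.isStrictlyPositive_iff_posDef.1 (hA.isStrictlyPositive.sqrt)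

theorem isHermitian_cfcSqrt (A : Matrix q q ℂ) : (CFC.sqrt A)ᴴ = CFC.sqrt A :=
  (Matrix.nonneg_iff_posSemidef.1 (CFC.sqrt_nonneg A)).1

theorem posDef_one_add_conjTranspose_mul_self (Z : Matrix p q ℂ) : (1 + Zᴴ * Z).PosDef :=
  Matrix.PosDef.one.add_posSemidef (posSemidef_conjTranspose_mul_self Z)

/-- The point `Z (I + Zᴴ Z) ^ (-1/2)` of the open matrix ball. -/
noncomputable def contraction (Z : Matrix p q ℂ) : Matrix p q ℂ :=
  Z * (CFC.sqrt (1 + Zᴴ * Z))⁻¹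

theorem one_sub_contraction_eq (Z : Matrix p q ℂ) :
    1 - (contraction Z)ᴴ * contraction Z =
      (CFC.sqrt (1 + Zᴴ * Z))⁻¹ * (CFC.sqrt (1 + Zᴴ * Z))⁻¹ := by
  have hR := (posDef_one_add_conjTranspose_mul_self Z).cfcSqrt
  have hsq := CFC.sqrt_mul_sqrt_self (1 + Zᴴ * Z)
    (posDef_one_add_conjTranspose_mul_self Z).posSemidef.nonneg
  have hRH := isHermitian_cfcSqrt (1 + Zᴴ * Z)
  rw [contraction]
  set R := CFC.sqrt (1 + Zᴴ * Z)
  have hu : IsUnit R.det := hR.isUnit.map Matrix.detMonoidHom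
  have hZ : Zᴴ * Z = R * R - 1 := by rw [hsq]; abel
  have h1 : R⁻¹ * R = 1 := nonsing_inv_mul _ hu
  have h2 : R * R⁻¹ = 1 := mul_nonsing_inv _ hu
  calc 1 - (Z * R⁻¹)ᴴ * (Z * R⁻¹) = 1 - R⁻¹ * (Zᴴ * Z) * R⁻¹ := by
        rw [conjTranspose_mul, conjTranspose_nonsing_inv, hRH]; simp only [Matrix.mul_assoc]
    _ = 1 - (R⁻¹ * R) * (R * R⁻¹) + R⁻¹ * R⁻¹ := by rw [hZ]; noncomm_ring
    _ = _ := by rw [h1, h2]; simp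

theorem contraction_mem_matrixBall (Z : Matrix p q ℂ) : contraction Z ∈ matrixBall p q := by
  have hR := (posDef_one_add_conjTranspose_mul_self Z).cfcSqrt.inv
  change (1 - (contraction Z)ᴴ * contraction Z).PosDef
  rw [one_sub_contraction_eq]
  refine (Matrix.PosSemidef.posDef_iff_isUnit ?_).2 (hR.isUnit.mul hR.isUnit)
  have := posSemidef_conjTranspose_mul_self (CFC.sqrt (1 + Zᴴ * Z))⁻¹
  rwa [hR.1] at this

theorem sqrt_one_sub_contraction (Z : Matrix p q ℂ) :
    CFC.sqrt (1 - (contraction Z)ᴴ * contraction Z) = (CFC.sqrt (1 + Zᴴ * Z))⁻¹ :=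
  CFC.sqrt_unique (one_sub_contraction_eq Z).symm
    (posDef_one_add_conjTranspose_mul_self Z).cfcSqrt.inv.posSemidef.nonneg

/-- The last block column of W(X) has ratio Z = X (I - Xᴴ X)^(-1/2), and I + Zᴴ Z = (I - Xᴴ X)⁻¹.
Uniqueness of the ball parameters rests on this inversion. -/
theorem contraction_mul_inv_sqrt {X : Matrix p q ℂ} (hX : X ∈ matrixBall p q) :
    contraction (X * (CFC.sqrt (1 - Xᴴ * X))⁻¹) = X := by
  have hX' : (1 - Xᴴ * X).PosDef := hX
  have hD := hX'.cfcSqrt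
  have hsq := CFC.sqrt_mul_sqrt_self (1 - Xᴴ * X) hX'.posSemidef.nonneg
  have hDH := isHermitian_cfcSqrt (1 - Xᴴ * X)
  rw [contraction]
  set D := CFC.sqrt (1 - Xᴴ * X)
  have hu : IsUnit D.det := hD.isUnit.map Matrix.detMonoidHom
  have h1 : D⁻¹ * D = 1 := nonsing_inv_mul _ hu
  have h2 : D * D⁻¹ = 1 := mul_nonsing_inv _ hu
  have hXX : Xᴴ * X = 1 - D * D := by rw [hsq]; abel
  have key : 1 + (X * D⁻¹)ᴴ * (X * D⁻¹) = D⁻¹ * D⁻¹ := by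
    calc 1 + (X * D⁻¹)ᴴ * (X * D⁻¹) = 1 + D⁻¹ * (Xᴴ * X) * D⁻¹ := by
          rw [conjTranspose_mul, conjTranspose_nonsing_inv, hDH]; simp only [Matrix.mul_assoc]
      _ = 1 - (D⁻¹ * D) * (D * D⁻¹) + D⁻¹ * D⁻¹ := by rw [hXX]; noncomm_ring
      _ = _ := by rw [h1, h2]; simp
  rw [key, CFC.sqrt_mul_self _ hD.inv.posSemidef.nonneg, nonsing_inv_nonsing_inv _ hu,
    Matrix.mul_assoc, h1, Matrix.mul_one]

theorem sqrt_mul_sqrt_one_sub {X : Matrix p q ℂ} (hX : X ∈ matrixBall p q) :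
    CFC.sqrt (1 - Xᴴ * X) * CFC.sqrt (1 - Xᴴ * X) = 1 - Xᴴ * X :=
  CFC.sqrt_mul_sqrt_self _ (Matrix.PosDef.posSemidef (M := 1 - Xᴴ * X) hX).nonneg

variable [DecidableEq p]

/-- I - Xᴴ X and I - X Xᴴ are the two Schur complements of the block matrix with rows (I, X) and
(Xᴴ, I). -/
theorem posSemidef_one_sub_mul_conjTranspose {X : Matrix p q ℂ} (hX : X ∈ matrixBall p q) :
    (1 - X * Xᴴ).PosSemidef := by
  have : Invertible (1 : Matrix p p ℂ) := invertibleOne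
  have : Invertible (1 : Matrix q q ℂ) := invertibleOne
  have h1 := (Matrix.PosDef.fromBlocks₁₁ X 1 (Matrix.PosDef.one (n := p) (R := ℂ))).2
    (by simpa using Matrix.PosDef.posSemidef (M := 1 - Xᴴ * X) hX)
  simpa using (Matrix.PosDef.fromBlocks₂₂ 1 X (Matrix.PosDef.one (n := q) (R := ℂ))).1 h1

theorem sqrt_mul_sqrt_one_sub' {X : Matrix p q ℂ} (hX : X ∈ matrixBall p q) :
    CFC.sqrt (1 - X * Xᴴ) * CFC.sqrt (1 - X * Xᴴ) = 1 - X * Xᴴ :=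
  CFC.sqrt_mul_sqrt_self _ (posSemidef_one_sub_mul_conjTranspose hX).nonneg

/-- The matrix with off-diagonal blocks X, Xᴴ commutes with diag(I - X Xᴴ, I - Xᴴ X), hence with its
square root; the upper right block of that identity is the claim. -/
theorem sqrt_one_sub_mul_comm {X : Matrix p q ℂ} (hX : X ∈ matrixBall p q) :
    CFC.sqrt (1 - X * Xᴴ) * X = X * CFC.sqrt (1 - Xᴴ * X) := by
  have hA := sqrt_mul_sqrt_one_sub' hX
  have hD := sqrt_mul_sqrt_one_sub hX
  have hA0 := CFC.sqrt_nonneg (1 - X * Xᴴ)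
  have hD0 := CFC.sqrt_nonneg (1 - Xᴴ * X)
  set A := CFC.sqrt (1 - X * Xᴴ)
  set D := CFC.sqrt (1 - Xᴴ * X)
  have hS0 : 0 ≤ fromBlocks A 0 0 D := by
    have := posSemidef_conjTranspose_mul_self (fromBlocks (CFC.sqrt A) 0 0 (CFC.sqrt D))
    rw [fromBlocks_conjTranspose, isHermitian_cfcSqrt, isHermitian_cfcSqrt,
      fromBlocks_multiply] at this
    simpa [CFC.sqrt_mul_sqrt_self A, CFC.sqrt_mul_sqrt_self D] using this.nonneg
  have hS : CFC.sqrt (fromBlocks (1 - X * Xᴴ) 0 0 (1 - Xᴴ * X)) = fromBlocks A 0 0 D :=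
    CFC.sqrt_unique (by simp [fromBlocks_multiply, hA, hD]) hS0
  have hcomm : Commute (fromBlocks (1 - X * Xᴴ) 0 0 (1 - Xᴴ * X)) (fromBlocks 0 X Xᴴ 0) := by
    rw [Commute, SemiconjBy, fromBlocks_multiply, fromBlocks_multiply]
    simp [Matrix.sub_mul, Matrix.mul_sub, Matrix.mul_assoc]
  have h := hcomm.cfc_nnreal NNReal.sqrt
  rw [← CFC.sqrt_eq_cfc, hS, Commute, SemiconjBy, fromBlocks_multiply, fromBlocks_multiply,
    fromBlocks_inj] at h
  simpa using h.2.1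

theorem conjTranspose_blockW (X : Matrix p q ℂ) : (blockW X)ᴴ =
    fromBlocks (CFC.sqrt (1 - X * Xᴴ)) (-X) Xᴴ (CFC.sqrt (1 - Xᴴ * X)) := by
  simp [blockW, fromBlocks_conjTranspose, isHermitian_cfcSqrt]

theorem conjTranspose_blockW_mul_self {X : Matrix p q ℂ} (hX : X ∈ matrixBall p q) :
    (blockW X)ᴴ * blockW X = 1 := by
  have h2 : CFC.sqrt (1 - Xᴴ * X) * Xᴴ = Xᴴ * CFC.sqrt (1 - X * Xᴴ) := by
    have := congrArg conjTranspose (sqrt_one_sub_mul_comm hX)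
    simpa [isHermitian_cfcSqrt] using this.symm
  rw [conjTranspose_blockW, blockW, fromBlocks_multiply, ← fromBlocks_one, fromBlocks_inj]
  refine ⟨?_, ?_, ?_, ?_⟩
  · rw [sqrt_mul_sqrt_one_sub' hX]; simp
  · rw [sqrt_one_sub_mul_comm hX]; simp
  · rw [Matrix.mul_neg, h2]; simp
  · rw [sqrt_mul_sqrt_one_sub hX]; simp

/-- This is the vanishing of the upper block of W(X)ᴴ applied to the column (Z, I), for X the
contraction of Z. -/
theorem sqrt_mul_eq_contraction (Z : Matrix p q ℂ) :
    CFC.sqrt (1 - contraction Z * (contraction Z)ᴴ) * Z = contraction Z := by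
  have hu : IsUnit (CFC.sqrt (1 + Zᴴ * Z)).det :=
    (posDef_one_add_conjTranspose_mul_self Z).cfcSqrt.isUnit.map Matrix.detMonoidHom
  have hZ : contraction Z * CFC.sqrt (1 + Zᴴ * Z) = Z := by
    rw [contraction, Matrix.mul_assoc, nonsing_inv_mul _ hu, Matrix.mul_one]
  calc CFC.sqrt (1 - contraction Z * (contraction Z)ᴴ) * Z
      = CFC.sqrt (1 - contraction Z * (contraction Z)ᴴ) *
          (contraction Z * CFC.sqrt (1 + Zᴴ * Z)) := by rw [hZ]
    _ = contraction Z := by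
      rw [← Matrix.mul_assoc, sqrt_one_sub_mul_comm (contraction_mem_matrixBall Z),
        sqrt_one_sub_contraction, Matrix.mul_assoc, nonsing_inv_mul _ hu, Matrix.mul_one]

end Ball

/-! ### A single elimination step. -/

section Elimination

variable {m : ℕ} (k : Fin m → ℕ) (j : Fin m)

/-- The part of the `j`-th block column lying above the diagonal block. -/
def upperBlock (Y : Matrix (BlockIndex k) (BlockIndex k) ℂ) :
    Matrix (BlocksBefore k j) (Fin (k j)) ℂ :=
  Y.submatrix Subtype.val fun b => ⟨j, b⟩

/-- The `j`-th diagonal block. -/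
def diagBlock (Y : Matrix (BlockIndex k) (BlockIndex k) ℂ) : Matrix (Fin (k j)) (Fin (k j)) ℂ :=
  Y.submatrix (fun a => ⟨j, a⟩) fun b => ⟨j, b⟩

/-- The point of the matrix ball read off from the `j`-th block column. -/
noncomputable def pivot (Y : Matrix (BlockIndex k) (BlockIndex k) ℂ) :
    Matrix (BlocksBefore k j) (Fin (k j)) ℂ :=
  contraction (upperBlock k j Y * (diagBlock k j Y)⁻¹)

/-- One elimination step: it annihilates the `j`-th block column above the diagonal. -/
noncomputable def peel (Y : Matrix (BlockIndex k) (BlockIndex k) ℂ) :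
    Matrix (BlockIndex k) (BlockIndex k) ℂ :=
  (extendedW k j (pivot k j Y))ᴴ * Y

/-- The block columns after the `j`-th one vanish above the diagonal blocks. -/
def LowerBeyond (Y : Matrix (BlockIndex k) (BlockIndex k) ℂ) : Prop :=
  ∀ p q : BlockIndex k, j < q.1 → p.1 < q.1 → Y p q = 0

variable {k j}

theorem reindex_blockSplit_mul_apply
    (N : Matrix ((BlocksBefore k j ⊕ Fin (k j)) ⊕ BlocksAfter k j)
      ((BlocksBefore k j ⊕ Fin (k j)) ⊕ BlocksAfter k j) ℂ)
    (Y : Matrix (BlockIndex k) (BlockIndex k) ℂ) (s) (c) :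
    (reindex (blockSplit k j) (blockSplit k j) N * Y) (blockSplit k j s) c =
      ∑ t, N s t * Y (blockSplit k j t) c := by
  rw [Matrix.mul_apply, ← (blockSplit k j).sum_comp]
  simp

theorem extendedW_mul_apply_before (X : Matrix (BlocksBefore k j) (Fin (k j)) ℂ)
    (Y : Matrix (BlockIndex k) (BlockIndex k) ℂ) (p : BlocksBefore k j) (c) :
    (extendedW k j X * Y) p.1 c =
      ∑ t, (CFC.sqrt (1 - X * Xᴴ) : Matrix _ _ ℂ) p t * Y t.1 c + ∑ b, X p b * Y ⟨j, b⟩ c := by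
  have := reindex_blockSplit_mul_apply (fromBlocks (blockW X) 0 0 1) Y (Sum.inl (Sum.inl p)) c
  rw [← extendedW] at this
  simpa [blockW, Fintype.sum_sum_type, blockSplit] using this

theorem extendedW_mul_apply_block (X : Matrix (BlocksBefore k j) (Fin (k j)) ℂ)
    (Y : Matrix (BlockIndex k) (BlockIndex k) ℂ) (a : Fin (k j)) (c) :
    (extendedW k j X * Y) ⟨j, a⟩ c =
      ∑ t, (-Xᴴ) a t * Y t.1 c + ∑ b, (CFC.sqrt (1 - Xᴴ * X) : Matrix _ _ ℂ) a b * Y ⟨j, b⟩ c := by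
  have := reindex_blockSplit_mul_apply (fromBlocks (blockW X) 0 0 1) Y (Sum.inl (Sum.inr a)) c
  rw [← extendedW] at this
  simpa [blockW, Fintype.sum_sum_type, blockSplit] using this

theorem conjTranspose_extendedW (X : Matrix (BlocksBefore k j) (Fin (k j)) ℂ) :
    (extendedW k j X)ᴴ = reindex (blockSplit k j) (blockSplit k j)
      (fromBlocks (fromBlocks (CFC.sqrt (1 - X * Xᴴ)) (-X) Xᴴ (CFC.sqrt (1 - Xᴴ * X))) 0 0 1) := by
  rw [extendedW, conjTranspose_reindex, fromBlocks_conjTranspose, conjTranspose_blockW]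
  simp

theorem conjTranspose_extendedW_mul_apply_before (X : Matrix (BlocksBefore k j) (Fin (k j)) ℂ)
    (Y : Matrix (BlockIndex k) (BlockIndex k) ℂ) (p : BlocksBefore k j) (c) :
    ((extendedW k j X)ᴴ * Y) p.1 c =
      ∑ t, (CFC.sqrt (1 - X * Xᴴ) : Matrix _ _ ℂ) p t * Y t.1 c - ∑ b, X p b * Y ⟨j, b⟩ c := by
  have := reindex_blockSplit_mul_apply (fromBlocks (fromBlocks (CFC.sqrt (1 - X * Xᴴ)) (-X) Xᴴ
    (CFC.sqrt (1 - Xᴴ * X))) 0 0 1) Y (Sum.inl (Sum.inl p)) c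
  rw [← conjTranspose_extendedW] at this
  simpa [Fintype.sum_sum_type, blockSplit, ← sub_eq_add_neg] using this

/-- A step at block j acts only on rows of blocks up to j, so it fixes columns that vanish there.
This is why cleared columns stay cleared. -/
theorem reindex_fromBlocks_mul_apply
    (W : Matrix (BlocksBefore k j ⊕ Fin (k j)) (BlocksBefore k j ⊕ Fin (k j)) ℂ)
    {Y : Matrix (BlockIndex k) (BlockIndex k) ℂ} {c : BlockIndex k}
    (hY : ∀ p : BlockIndex k, p.1 ≤ j → Y p c = 0) (p : BlockIndex k) :
    (reindex (blockSplit k j) (blockSplit k j) (fromBlocks W 0 0 1) * Y) p c = Y p c := by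
  have h : ∀ t, Y (blockSplit k j (Sum.inl t)) c = 0 := by
    rintro (t | t)
    · exact hY _ t.2.le
    · exact hY _ le_rfl
  obtain ⟨s, rfl⟩ := (blockSplit k j).surjective p
  rw [reindex_blockSplit_mul_apply, Fintype.sum_sum_type]
  rcases s with s | s <;> simp [h, Matrix.one_apply]

theorem extendedW_mul_apply_of_forall_eq_zero (X : Matrix (BlocksBefore k j) (Fin (k j)) ℂ)
    {Y : Matrix (BlockIndex k) (BlockIndex k) ℂ} {c : BlockIndex k}
    (hY : ∀ p : BlockIndex k, p.1 ≤ j → Y p c = 0) (p : BlockIndex k) :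
    (extendedW k j X * Y) p c = Y p c :=
  reindex_fromBlocks_mul_apply _ hY p

theorem conjTranspose_extendedW_mul_apply_of_forall_eq_zero
    (X : Matrix (BlocksBefore k j) (Fin (k j)) ℂ)
    {Y : Matrix (BlockIndex k) (BlockIndex k) ℂ} {c : BlockIndex k}
    (hY : ∀ p : BlockIndex k, p.1 ≤ j → Y p c = 0) (p : BlockIndex k) :
    ((extendedW k j X)ᴴ * Y) p c = Y p c := by
  rw [conjTranspose_extendedW]
  exact reindex_fromBlocks_mul_apply _ hY p

theorem conjTranspose_extendedW_mul_self {X : Matrix (BlocksBefore k j) (Fin (k j)) ℂ}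
    (hX : X ∈ matrixBall (BlocksBefore k j) (Fin (k j))) :
    (extendedW k j X)ᴴ * extendedW k j X = 1 := by
  rw [extendedW, conjTranspose_reindex, reindex_apply, reindex_apply, submatrix_mul_equiv,
    fromBlocks_conjTranspose, fromBlocks_multiply]
  simp [conjTranspose_blockW_mul_self hX]

theorem extendedW_mul_conjTranspose {X : Matrix (BlocksBefore k j) (Fin (k j)) ℂ}
    (hX : X ∈ matrixBall (BlocksBefore k j) (Fin (k j))) :
    extendedW k j X * (extendedW k j X)ᴴ = 1 :=
  mul_eq_one_comm.1 (conjTranspose_extendedW_mul_self hX)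

theorem pivot_mem_matrixBall (Y : Matrix (BlockIndex k) (BlockIndex k) ℂ) :
    pivot k j Y ∈ matrixBall (BlocksBefore k j) (Fin (k j)) :=
  contraction_mem_matrixBall _

theorem extendedW_pivot_mul_peel (Y : Matrix (BlockIndex k) (BlockIndex k) ℂ) :
    extendedW k j (pivot k j Y) * peel k j Y = Y := by
  rw [peel, ← Matrix.mul_assoc, extendedW_mul_conjTranspose (pivot_mem_matrixBall Y),
    Matrix.one_mul]

theorem peel_apply_eq_zero_of_isUnit {Y : Matrix (BlockIndex k) (BlockIndex k) ℂ}
    (hY : IsUnit (diagBlock k j Y).det) {p : BlockIndex k} (hp : p.1 < j) (b : Fin (k j)) :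
    peel k j Y p ⟨j, b⟩ = 0 := by
  have h := conjTranspose_extendedW_mul_apply_before (pivot k j Y) Y ⟨p, hp⟩ ⟨j, b⟩
  have key : CFC.sqrt (1 - pivot k j Y * (pivot k j Y)ᴴ) * upperBlock k j Y =
      pivot k j Y * diagBlock k j Y := by
    have h1 := sqrt_mul_eq_contraction (upperBlock k j Y * (diagBlock k j Y)⁻¹)
    have h2 : upperBlock k j Y = upperBlock k j Y * (diagBlock k j Y)⁻¹ * diagBlock k j Y := by
      rw [Matrix.mul_assoc, nonsing_inv_mul _ hY, Matrix.mul_one]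
    change CFC.sqrt (1 - pivot k j Y * (pivot k j Y)ᴴ) * _ = pivot k j Y at h1
    rw [h2, ← Matrix.mul_assoc, h1]
  have := congrFun (congrFun key ⟨p, hp⟩) b
  rw [Matrix.mul_apply, Matrix.mul_apply] at this
  exact h.trans (sub_eq_zero.2 this)

/-- If `Y` is already reduced beyond block `j`, the elimination step only uses block column `j`,
which makes it equivariant under right multiplication by block lower triangular matrices. -/
theorem peel_mul_of_lowerBeyond {Y S : Matrix (BlockIndex k) (BlockIndex k) ℂ}
    (hY : LowerBeyond k j Y) (hS : ∀ p q : BlockIndex k, p.1 < q.1 → S p q = 0)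
    (hYS : IsUnit (diagBlock k j (Y * S)).det) :
    IsUnit (diagBlock k j Y).det ∧ peel k j (Y * S) = peel k j Y * S := by
  have hcol : ∀ p : BlockIndex k, p.1 ≤ j → ∀ b : Fin (k j),
      (Y * S) p ⟨j, b⟩ = ∑ a, Y p ⟨j, a⟩ * S ⟨j, a⟩ ⟨j, b⟩ := by
    intro p hp b
    -- Blocks before j drop out because S is block lower triangular, blocks after j because Y is
    -- already reduced there.
    rw [Matrix.mul_apply, Fintype.sum_sigma, Finset.sum_eq_single j]
    · intro i _ hij
      refine Finset.sum_eq_zero fun a _ => ?_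
      rcases lt_or_gt_of_ne hij with h | h
      · rw [hS ⟨i, a⟩ ⟨j, b⟩ h, mul_zero]
      · rw [hY p ⟨i, a⟩ h (lt_of_le_of_lt hp h), zero_mul]
    · simp
  have hd : diagBlock k j (Y * S) = diagBlock k j Y * diagBlock k j S := by
    ext a b
    exact hcol ⟨j, a⟩ le_rfl b
  have hu : upperBlock k j (Y * S) = upperBlock k j Y * diagBlock k j S := by
    ext a b
    exact hcol a.1 a.2.le b
  rw [hd, det_mul, IsUnit.mul_iff] at hYS
  refine ⟨hYS.1, ?_⟩
  have hp : pivot k j (Y * S) = pivot k j Y := by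
    rw [pivot, pivot, hu, hd, Matrix.mul_inv_rev, Matrix.mul_assoc,
      ← Matrix.mul_assoc (diagBlock k j S), mul_nonsing_inv _ hYS.2, Matrix.one_mul]
  rw [peel, hp, peel, Matrix.mul_assoc]

/-- Block column j of the product has upper part X N_jj and diagonal block (I - Xᴴ X)^(1/2) N_jj;
the factor N_jj cancels in the ratio. -/
theorem pivot_extendedW_mul {X : Matrix (BlocksBefore k j) (Fin (k j)) ℂ}
    (hX : X ∈ matrixBall (BlocksBefore k j) (Fin (k j)))
    {N : Matrix (BlockIndex k) (BlockIndex k) ℂ}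
    (hN : ∀ (p : BlockIndex k) (b : Fin (k j)), p.1 < j → N p ⟨j, b⟩ = 0)
    (hu : IsUnit (diagBlock k j N).det) :
    pivot k j (extendedW k j X * N) = X := by
  have hN' : ∀ (p : BlocksBefore k j) (b : Fin (k j)), N p.1 ⟨j, b⟩ = 0 := fun p b => hN _ b p.2
  have h1 : upperBlock k j (extendedW k j X * N) = X * diagBlock k j N := by
    ext p b
    refine (extendedW_mul_apply_before X N p ⟨j, b⟩).trans ?_
    simp [hN', Matrix.mul_apply, diagBlock]
  have h2 : diagBlock k j (extendedW k j X * N) = CFC.sqrt (1 - Xᴴ * X) * diagBlock k j N := by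
    ext a b
    refine (extendedW_mul_apply_block X N a ⟨j, b⟩).trans ?_
    simp [hN', Matrix.mul_apply, diagBlock]
  rw [pivot, h1, h2, Matrix.mul_inv_rev, Matrix.mul_assoc, ← Matrix.mul_assoc (diagBlock k j N),
    mul_nonsing_inv _ hu, Matrix.one_mul, contraction_mul_inv_sqrt hX]

end Elimination

/-- Replaces the reversed list product by a recursion whose intermediate values can be compared with
the residuals. -/
theorem Fin.induction_mul_last {M : Type*} [Monoid M] {m : ℕ} (f : Fin m → M) (a : M) :
    Fin.induction (motive := fun _ => M) a (fun i y => f i * y) (Fin.last m) =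
      (List.ofFn f).reverse.prod * a := by
  induction m generalizing a with
  | zero => simp [Fin.last]
  | succ m ih =>
    rw [List.ofFn_succ, List.reverse_cons, List.prod_append, List.prod_singleton, mul_assoc,
      ← ih (fun i => f i.succ) (f 0 * a)]
    have h : ∀ j : Fin (m + 1),
        Fin.induction (motive := fun _ => M) a (fun i y => f i * y) j.succ =
          Fin.induction (motive := fun _ => M) (f 0 * a) (fun i y => f i.succ * y) j := by
      intro j
      induction j using Fin.induction with
      | zero => rfl
      | succ i ih => rw [Fin.induction_succ, Fin.induction_succ, ← ih]; rfl
    exact h (Fin.last m)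

/-! ### The full elimination: existence and uniqueness. -/

section Residual

variable {m : ℕ} (k : Fin (m + 1) → ℕ)

/-- The matrix obtained from `M` after eliminating all block columns beyond the `j`-th one. -/
noncomputable def columnResidual (M : Matrix (BlockIndex k) (BlockIndex k) ℂ) (j : Fin (m + 1)) :
    Matrix (BlockIndex k) (BlockIndex k) ℂ :=
  Fin.reverseInduction (motive := fun _ => Matrix (BlockIndex k) (BlockIndex k) ℂ) M
    (fun i Y => peel k i.succ Y) j

/-- All diagonal blocks met during the elimination are invertible. -/
def BlockNondegenerate (M : Matrix (BlockIndex k) (BlockIndex k) ℂ) : Prop :=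
  ∀ i : Fin m, IsUnit (diagBlock k i.succ (columnResidual k M i.succ)).det

variable {k}

@[simp]
theorem columnResidual_last (M : Matrix (BlockIndex k) (BlockIndex k) ℂ) :
    columnResidual k M (Fin.last m) = M :=
  Fin.reverseInduction_last ..

theorem columnResidual_castSucc (M : Matrix (BlockIndex k) (BlockIndex k) ℂ) (i : Fin m) :
    columnResidual k M i.castSucc = peel k i.succ (columnResidual k M i.succ) :=
  Fin.reverseInduction_castSucc ..

theorem eq_or_succ_lt_of_castSucc_lt {i : Fin m} {j : Fin (m + 1)} (h : i.castSucc < j) :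
    j = i.succ ∨ i.succ < j := by
  simp only [Fin.lt_def, Fin.ext_iff, Fin.val_castSucc, Fin.val_succ] at *
  lia

theorem lowerBeyond_columnResidual {M : Matrix (BlockIndex k) (BlockIndex k) ℂ} {j : Fin (m + 1)}
    (h : ∀ i : Fin m, j < i.succ → IsUnit (diagBlock k i.succ (columnResidual k M i.succ)).det) :
    LowerBeyond k j (columnResidual k M j) := by
  induction j using Fin.reverseInduction with
  | last => exact fun p q hq => absurd hq (Fin.le_last _).not_gt
  | cast i ih =>
    have ih := ih fun i' hi' => h i' (Fin.castSucc_lt_succ.trans hi')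
    have hi := h i Fin.castSucc_lt_succ
    rw [columnResidual_castSucc]
    rintro p ⟨l, b⟩ hq hpq
    rcases eq_or_succ_lt_of_castSucc_lt hq with hl | hl
    · obtain rfl : l = i.succ := hl
      exact peel_apply_eq_zero_of_isUnit hi hpq b
    · rw [peel, conjTranspose_extendedW_mul_apply_of_forall_eq_zero]
      · exact ih _ _ hl hpq
      · exact fun p' hp' => ih _ _ hl (lt_of_le_of_lt hp' hl)

/-- Elimination commutes with right multiplication by S as long as the blocks met are invertible.
Contrapositively, the degenerate set is stable under such multiplication, even for singular S. -/
theorem blockNondegenerate_of_mul {M S : Matrix (BlockIndex k) (BlockIndex k) ℂ}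
    (hS : ∀ p q : BlockIndex k, p.1 < q.1 → S p q = 0) (h : BlockNondegenerate k (M * S)) :
    BlockNondegenerate k M := by
  have key : ∀ j : Fin (m + 1),
      (∀ i : Fin m, j < i.succ → IsUnit (diagBlock k i.succ (columnResidual k M i.succ)).det) ∧
        columnResidual k (M * S) j = columnResidual k M j * S := by
    intro j
    induction j using Fin.reverseInduction with
    | last => exact ⟨fun i hi => absurd hi (Fin.le_last _).not_gt, by simp⟩
    | cast i ih =>
      have hi := h i
      rw [ih.2] at hi
      have h1 := peel_mul_of_lowerBeyond (lowerBeyond_columnResidual ih.1) hS hi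
      refine ⟨fun i' hi' => ?_, ?_⟩
      · rcases eq_or_succ_lt_of_castSucc_lt hi' with h2 | h2
        · obtain rfl := Fin.succ_injective _ h2
          exact h1.1
        · exact ih.1 i' h2
      · rw [columnResidual_castSucc, ih.2, h1.2, columnResidual_castSucc]
  exact fun i => (key 0).1 i (Fin.succ_pos i)

/-- The transformation producing the `j`-th residual is unitary and only depends on the block
columns beyond the `j`-th one. -/
theorem exists_columnResidual_eq_mul (M : Matrix (BlockIndex k) (BlockIndex k) ℂ) (j : Fin (m + 1)) :
    ∃ Q : Matrix (BlockIndex k) (BlockIndex k) ℂ, Q * Qᴴ = 1 ∧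
      ∀ M' : Matrix (BlockIndex k) (BlockIndex k) ℂ,
        (∀ p q : BlockIndex k, j < q.1 → M' p q = M p q) → columnResidual k M' j = Q * M' := by
  induction j using Fin.reverseInduction with
  | last => exact ⟨1, by simp, fun M' _ => by simp⟩
  | cast i ih =>
    obtain ⟨Q, hQ, hM⟩ := ih
    have hE := conjTranspose_extendedW_mul_self
      (pivot_mem_matrixBall (k := k) (j := i.succ) (Q * M))
    refine ⟨(extendedW k i.succ (pivot k i.succ (Q * M)))ᴴ * Q, ?_, fun M' hM' => ?_⟩
    · rw [conjTranspose_mul, conjTranspose_conjTranspose, Matrix.mul_assoc, ← Matrix.mul_assoc Q,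
        hQ, Matrix.one_mul, hE]
    · have hcol : ∀ (p : BlockIndex k) (b : Fin (k i.succ)),
          (Q * M') p ⟨i.succ, b⟩ = (Q * M) p ⟨i.succ, b⟩ := by
        intro p b
        simp only [Matrix.mul_apply]
        exact Finset.sum_congr rfl fun t _ => by rw [hM' _ _ Fin.castSucc_lt_succ]
      have hp : pivot k i.succ (Q * M') = pivot k i.succ (Q * M) := by
        have h1 : upperBlock k i.succ (Q * M') = upperBlock k i.succ (Q * M) := by
          ext p b; exact hcol _ _
        have h2 : diagBlock k i.succ (Q * M') = diagBlock k i.succ (Q * M) := by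
          ext p b; exact hcol _ _
        rw [pivot, h1, h2, pivot]
      rw [columnResidual_castSucc, hM M' fun p q hq => hM' p q (Fin.castSucc_lt_succ.trans hq), peel, hp,
        Matrix.mul_assoc]

theorem conjTranspose_columnResidual_mul_self {g : Matrix (BlockIndex k) (BlockIndex k) ℂ}
    (hg : gᴴ * g = 1) (j : Fin (m + 1)) : (columnResidual k g j)ᴴ * columnResidual k g j = 1 := by
  obtain ⟨Q, hQ, h⟩ := exists_columnResidual_eq_mul g j
  rw [h g fun _ _ _ => rfl, conjTranspose_mul, Matrix.mul_assoc, ← Matrix.mul_assoc Qᴴ,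
    mul_eq_one_comm.1 hQ, Matrix.one_mul, hg]

/-- The steps telescope. No nondegeneracy is needed: the pivot lies in the ball even when a singular
block has inverse 0 by convention. -/
theorem eq_cosetProduct_mul_columnResidual (g : Matrix (BlockIndex k) (BlockIndex k) ℂ) :
    g = cosetProduct k (fun i => ⟨pivot k i.succ (columnResidual k g i.succ), pivot_mem_matrixBall _⟩) *
      columnResidual k g 0 := by
  rw [cosetProduct, ← Fin.induction_mul_last]
  have h : ∀ j : Fin (m + 1), Fin.induction
      (motive := fun _ => Matrix (BlockIndex k) (BlockIndex k) ℂ) (columnResidual k g 0)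
      (fun i y => extendedW k i.succ (pivot k i.succ (columnResidual k g i.succ)) * y) j =
        columnResidual k g j := by
    intro j
    induction j using Fin.induction with
    | zero => rfl
    | succ i ih => rw [Fin.induction_succ, ih, columnResidual_castSucc, extendedW_pivot_mul_peel]
  exact ((h (Fin.last m)).trans (columnResidual_last g)).symm

/-- A block lower triangular unitary matrix is block diagonal. -/
theorem eq_zero_of_conjTranspose_mul_self {h : Matrix (BlockIndex k) (BlockIndex k) ℂ}
    (hu : hᴴ * h = 1) (hl : ∀ p q : BlockIndex k, p.1 < q.1 → h p q = 0) {p q : BlockIndex k}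
    (hpq : p.1 ≠ q.1) : h p q = 0 := by
  rcases lt_or_gt_of_ne hpq with h' | h'
  · exact hl p q h'
  -- The adjoint is block upper triangular, and so is its inverse, which is h itself.
  have hT : (hᴴ).BlockTriangular Sigma.fst := fun a b hab => by
    rw [conjTranspose_apply, hl b a hab, star_zero]
  have : Invertible hᴴ := invertibleOfRightInverse _ _ hu
  have hI := blockTriangular_inv_of_blockTriangular hT
  rw [inv_eq_right_inv hu] at hI
  exact hI h'

theorem eq_blockDiagonal'_diagBlock {h : Matrix (BlockIndex k) (BlockIndex k) ℂ}
    (hd : ∀ p q : BlockIndex k, p.1 ≠ q.1 → h p q = 0) :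
    h = blockDiagonal' fun j => diagBlock k j h := by
  ext ⟨i, a⟩ ⟨j, b⟩
  rcases eq_or_ne i j with rfl | hij
  · rw [blockDiagonal'_apply_eq]; rfl
  · rw [hd _ _ hij, blockDiagonal'_apply_ne _ _ _ hij]

/-- Elimination undoes the product factor by factor: the residuals are exactly the partial products.
-/
theorem columnResidual_cosetProduct_mul (X : BallParameters k)
    (V : (j : Fin (m + 1)) → Matrix.unitaryGroup (Fin (k j)) ℂ) :
    (∀ i : Fin m, pivot k i.succ (columnResidual k (cosetProduct k X * blockDiagonal' fun j =>
        (V j : Matrix (Fin (k j)) (Fin (k j)) ℂ)) i.succ) = (X i).1) ∧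
      columnResidual k (cosetProduct k X * blockDiagonal' fun j =>
        (V j : Matrix (Fin (k j)) (Fin (k j)) ℂ)) 0 =
        blockDiagonal' fun j => (V j : Matrix (Fin (k j)) (Fin (k j)) ℂ) := by
  rw [cosetProduct, ← Fin.induction_mul_last]
  set h := blockDiagonal' fun j => (V j : Matrix (Fin (k j)) (Fin (k j)) ℂ) with hh
  set N := Fin.induction (motive := fun _ => Matrix (BlockIndex k) (BlockIndex k) ℂ) h
    (fun i y => extendedW k i.succ (X i).1 * y) with hN
  have hh0 : ∀ p q : BlockIndex k, p.1 ≠ q.1 → h p q = 0 := fun p q hpq =>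
    blockDiagonal'_apply_ne _ _ _ hpq
  have hNs : ∀ i : Fin m, N i.succ = extendedW k i.succ (X i).1 * N i.castSucc := fun i =>
    Fin.induction_succ ..
  -- The factors up to block j do not touch the later columns of h, which vanish in the rows on
  -- which those factors act.
  have hcol : ∀ (j : Fin (m + 1)) (p q : BlockIndex k), j < q.1 → N j p q = h p q := by
    intro j
    induction j using Fin.induction with
    | zero => exact fun p q _ => rfl
    | succ i ih =>
      intro p q hq
      have hq' := Fin.castSucc_lt_succ.trans hq
      rw [hNs, extendedW_mul_apply_of_forall_eq_zero, ih p q hq']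
      exact fun p' hp' => (ih p' q hq').trans (hh0 _ _ (lt_of_le_of_lt hp' hq).ne)
  have hpiv : ∀ i : Fin m, pivot k i.succ (N i.succ) = (X i).1 := by
    intro i
    rw [hNs]
    refine pivot_extendedW_mul (X i).2 (fun p b hp => ?_) ?_
    · exact (hcol _ _ _ Fin.castSucc_lt_succ).trans (hh0 _ _ hp.ne)
    · have : diagBlock k i.succ (N i.castSucc) = V i.succ := by
        ext a b
        exact (hcol _ _ _ Fin.castSucc_lt_succ).trans (blockDiagonal'_apply_eq _ _ _ _)
      rw [this]
      exact (Unitary.isUnit_coe (U := V i.succ)).map Matrix.detMonoidHom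
  have hres : ∀ j : Fin (m + 1), columnResidual k (N (Fin.last m)) j = N j := by
    intro j
    induction j using Fin.reverseInduction with
    | last => simp
    | cast i ih =>
      rw [columnResidual_castSucc, ih, peel, hpiv, hNs, ← Matrix.mul_assoc,
        conjTranspose_extendedW_mul_self (X i).2, Matrix.one_mul]
  exact ⟨fun i => by rw [hres, hpiv], hres 0⟩

theorem existsUnique_cosetProduct_of_blockNondegenerate {g : Matrix (BlockIndex k) (BlockIndex k) ℂ}
    (hg : gᴴ * g = 1) (hnd : BlockNondegenerate k g) :
    ∃! P : BallParameters k × ((j : Fin (m + 1)) → Matrix.unitaryGroup (Fin (k j)) ℂ),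
      g = cosetProduct k P.1 *
        blockDiagonal' fun j => (P.2 j : Matrix (Fin (k j)) (Fin (k j)) ℂ) := by
  have hu := conjTranspose_columnResidual_mul_self hg 0
  have hl := lowerBeyond_columnResidual (M := g) (j := 0) fun i _ => hnd i
  have hd := eq_blockDiagonal'_diagBlock (h := columnResidual k g 0)
    fun p q hpq => eq_zero_of_conjTranspose_mul_self hu
    (fun p q hpq => hl p q (lt_of_le_of_lt (Fin.zero_le _) hpq) hpq) hpq
  have hV : ∀ j, diagBlock k j (columnResidual k g 0) ∈ Matrix.unitaryGroup (Fin (k j)) ℂ := by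
    intro j
    rw [hd, blockDiagonal'_conjTranspose, ← blockDiagonal'_mul, ← blockDiagonal'_one] at hu
    exact Matrix.mem_unitaryGroup_iff'.2 (congrFun (blockDiagonal'_injective hu) j)
  refine ⟨(fun i => ⟨pivot k i.succ (columnResidual k g i.succ), pivot_mem_matrixBall _⟩,
    fun j => ⟨_, hV j⟩), ?_, ?_⟩
  · exact (eq_cosetProduct_mul_columnResidual g).trans (congrArg _ hd)
  · rintro ⟨X, V⟩ rfl
    obtain ⟨h1, h2⟩ := columnResidual_cosetProduct_mul X V
    refine Prod.ext ?_ ?_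
    · exact funext fun i => Subtype.ext (h1 i).symm
    · refine funext fun j => Subtype.ext ?_
      refine Eq.trans ?_ (congrArg (diagBlock k j) h2).symm
      ext a b
      exact (blockDiagonal'_apply_eq
        (fun j => (V j : Matrix (Fin (k j)) (Fin (k j)) ℂ)) j a b).symm

end Residual

/-! ### From null sets of matrices to null sets of U(n). -/

section Chart

open MeasureTheory Topology

instance isAddHaarMeasure_volume_realMatrix {ι κ : Type} [Fintype ι] [Fintype κ] :
    (volume : Measure (ι → κ → ℝ)).IsAddHaarMeasure :=
  Measure.pi.isAddHaarMeasure fun _ : ι => (volume : Measure (κ → ℝ))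

instance isAddHaarMeasure_volume_complexMatrix {ι κ : Type} [Fintype ι] [Fintype κ] :
    (volume : Measure (ι → κ → ℂ)).IsAddHaarMeasure :=
  Measure.pi.isAddHaarMeasure fun _ : ι => (volume : Measure (κ → ℂ))

variable {ι : Type} [Fintype ι] [DecidableEq ι] {α : Type} [LinearOrder α] (f : ι → α)

/-- Lower triangular matrices with real diagonal, parametrized by real matrices. -/
noncomputable def lowerTriangular (c : ι → ι → ℝ) : Matrix ι ι ℂ :=
  Matrix.of fun p q => if p = q then (c p p : ℂ) else
    if f q < f p then (c p q : ℂ) + c q p * Complex.I else 0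

omit [Fintype ι] in
theorem lowerTriangular_apply_of_lt (c : ι → ι → ℝ) {p q : ι} (h : f p < f q) :
    lowerTriangular f c p q = 0 := by
  have : p ≠ q := fun e => h.ne (congrArg f e)
  simp [lowerTriangular, this, h.not_gt]

omit [Fintype ι] in
theorem lowerTriangular_one : lowerTriangular f (fun p q => if p = q then 1 else 0) = 1 := by
  ext p q
  rcases eq_or_ne p q with rfl | h
  · simp [lowerTriangular]
  · simp [lowerTriangular, h, Ne.symm h]

omit [Fintype ι] in
theorem lowerTriangular_add_smul (c d : ι → ι → ℝ) (t : ℝ) :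
    lowerTriangular f (c + t • d) = lowerTriangular f c + (t : ℂ) • lowerTriangular f d := by
  ext p q
  simp only [lowerTriangular, of_apply, Pi.add_apply, Pi.smul_apply, smul_eq_mul, Matrix.add_apply,
    Matrix.smul_apply]
  split_ifs <;> push_cast <;> ring

omit [Fintype ι] in
-- Infinitesimal transversality: off the diagonal only one of the two summands contributes, and on
-- it twice a real number vanishes.
theorem eq_zero_of_lowerTriangular_add_conjTranspose {f : ι → α} (hf : Function.Injective f)
    {c : ι → ι → ℝ} (h : lowerTriangular f c + (lowerTriangular f c)ᴴ = 0) : c = 0 := by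
  have key : ∀ p q, f q < f p → c p q = 0 ∧ c q p = 0 := by
    intro p q hpq
    have hne : p ≠ q := fun e => hpq.ne (congrArg f e.symm)
    have h1 := congrFun (congrFun h p) q
    simp only [Matrix.add_apply, conjTranspose_apply, lowerTriangular_apply_of_lt f c hpq, star_zero,
      add_zero, Matrix.zero_apply] at h1
    simpa [lowerTriangular, hne, hpq, Complex.ext_iff] using h1
  funext p q
  rcases lt_trichotomy (f p) (f q) with hpq | hpq | hpq
  · exact (key q p hpq).2
  · obtain rfl := hf hpq
    have h1 := congrFun (congrFun h p) p
    simp only [Matrix.add_apply, conjTranspose_apply, lowerTriangular, of_apply, if_true,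
      Matrix.zero_apply, Complex.star_def, Complex.conj_ofReal, ← Complex.ofReal_add,
      Complex.ofReal_eq_zero] at h1
    change c p p = 0
    linarith
  · exact (key p q hpq).1

variable {E : Type*} [NormedAddCommGroup E] [NormedSpace ℝ E]

theorem contDiffAt_mul_lowerTriangular {ψ : E → ι → ι → ℂ} {x : E} (hψ : ContDiffAt ℝ 1 ψ x)
    (c : ι → ι → ℝ) : ContDiffAt ℝ 1 (fun (w : (ι → ι → ℝ) × E) (p q : ι) =>
      ∑ r, ψ w.2 p r * lowerTriangular f w.1 r q) (c, x) := by
  refine contDiffAt_pi.2 fun p => contDiffAt_pi.2 fun q => ContDiffAt.sum fun r _ => ?_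
  refine ContDiffAt.mul ?_ ?_
  · have h : ContDiffAt ℝ 1 (fun w : (ι → ι → ℝ) × E => ψ w.2) (c, x) :=
      ContDiffAt.comp (c, x) hψ contDiffAt_snd
    exact contDiffAt_pi.1 (contDiffAt_pi.1 h p) r
  · have hc : ∀ a b : ι, ContDiff ℝ 1 fun w : (ι → ι → ℝ) × E => ((w.1 a b : ℝ) : ℂ) := fun a b =>
      Complex.ofRealCLM.contDiff.comp (by fun_prop)
    unfold lowerTriangular
    simp only [of_apply]
    split_ifs
    · exact (hc _ _).contDiffAt
    · exact ((hc _ _).add ((hc _ _).mul contDiff_const)).contDiffAt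
    · exact contDiffAt_const

variable {f} in
/-- The derivative of `(c, x) ↦ ψ x * lowerTriangular f c` at the identity parameter is injective
when `ψ` is an immersion into the unitary group: a skew-Hermitian lower triangular matrix with real
diagonal vanishes. -/
theorem injective_fderiv_mul_lowerTriangular (hf : Function.Injective f) {ψ : E → ι → ι → ℂ}
    {x : E} (hψ : ContDiffAt ℝ 1 ψ x) (hu : ∀ᶠ y in 𝓝 x, (Matrix.of (ψ y))ᴴ * Matrix.of (ψ y) = 1)
    (hinj : Function.Injective (fderiv ℝ ψ x)) :
    Function.Injective (fderiv ℝ (fun (w : (ι → ι → ℝ) × E) (p q : ι) =>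
      ∑ r, ψ w.2 p r * lowerTriangular f w.1 r q) ((fun p q => if p = q then 1 else 0), x)) := by
  set c₁ : ι → ι → ℝ := fun p q => if p = q then 1 else 0 with hc₁
  set Φ := fun (w : (ι → ι → ℝ) × E) (p q : ι) => ∑ r, ψ w.2 p r * lowerTriangular f w.1 r q
  refine (injective_iff_map_eq_zero _).2 ?_
  rintro ⟨c, v⟩ hw
  set P : Matrix ι ι ℂ := Matrix.of (fderiv ℝ ψ x v) with hP
  set U : Matrix ι ι ℂ := Matrix.of (ψ x) with hU
  have hline : HasDerivAt (fun t : ℝ => x + t • v) v 0 := by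
    simpa using ((hasDerivAt_id (0 : ℝ)).smul_const v).const_add x
  have hψd : HasDerivAt (fun t : ℝ => ψ (x + t • v)) (fderiv ℝ ψ x v) 0 := by
    have h : HasFDerivAt ψ (fderiv ℝ ψ x) (x + (0 : ℝ) • v) := by
      simpa using (hψ.differentiableAt one_ne_zero).hasFDerivAt
    exact h.comp_hasDerivAt 0 hline
  have hψe : ∀ p q, HasDerivAt (fun t : ℝ => ψ (x + t • v) p q) (P p q) 0 := fun p q =>
    hasDerivAt_pi.1 (hasDerivAt_pi.1 hψd p) q
  have hΛe : ∀ p q, HasDerivAt (fun t : ℝ => lowerTriangular f (c₁ + t • c) p q)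
      (lowerTriangular f c p q) 0 := by
    intro p q
    simp only [lowerTriangular_add_smul, Matrix.add_apply, Matrix.smul_apply, smul_eq_mul]
    have := ((hasDerivAt_id (0 : ℝ)).ofReal_comp.mul_const
      (lowerTriangular f c p q)).const_add (lowerTriangular f c₁ p q)
    simpa using this
  have hwline : HasDerivAt (fun t : ℝ => (c₁ + t • c, x + t • v)) (c, v) 0 := by
    refine HasDerivAt.prodMk ?_ hline
    simpa using ((hasDerivAt_id (0 : ℝ)).smul_const c).const_add c₁
  have hΦd : HasDerivAt (fun t : ℝ => Φ (c₁ + t • c, x + t • v)) 0 0 := by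
    have h : HasFDerivAt Φ (fderiv ℝ Φ (c₁, x)) (c₁ + (0 : ℝ) • c, x + (0 : ℝ) • v) := by
      simpa using
        ((contDiffAt_mul_lowerTriangular f hψ c₁).differentiableAt one_ne_zero).hasFDerivAt
    have := h.comp_hasDerivAt 0 hwline
    rwa [hw] at this
  -- The derivative of the product along the line through (1, x) in the kernel direction (c, v).
  have h1 : P + U * lowerTriangular f c = 0 := by
    ext p q
    have h2 := hasDerivAt_pi.1 (hasDerivAt_pi.1 hΦd p) q
    have h3 := HasDerivAt.fun_sum fun r (_ : r ∈ Finset.univ) => (hψe p r).mul (hΛe r q)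
    have h4 := h3.unique h2
    simp only [zero_smul, add_zero, hc₁, lowerTriangular_one] at h4
    rw [Finset.sum_add_distrib, ← Matrix.mul_apply, Matrix.mul_one] at h4
    rw [Matrix.add_apply, Matrix.mul_apply]
    exact h4
  -- The derivative of the unitarity relation along the same line.
  have h2 : Pᴴ * U + Uᴴ * P = 0 := by
    ext p q
    have h3 := HasDerivAt.fun_sum fun r (_ : r ∈ Finset.univ) => (hψe r p).star.mul (hψe r q)
    have h4 : HasDerivAt (fun t : ℝ => ∑ r, star (ψ (x + t • v) r p) * ψ (x + t • v) r q) 0 0 := by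
      refine (hasDerivAt_const (0 : ℝ) ((1 : Matrix ι ι ℂ) p q)).congr_of_eventuallyEq ?_
      have hc : Filter.Tendsto (fun t : ℝ => x + t • v) (𝓝 0) (𝓝 x) := by
        simpa using hline.continuousAt.tendsto
      filter_upwards [hc.eventually hu] with t ht
      exact congrFun (congrFun ht p) q
    have h5 := h3.unique h4
    simp only [zero_smul, add_zero] at h5
    rw [Finset.sum_add_distrib] at h5
    exact h5
  have hUU : Uᴴ * U = 1 := hu.self_of_nhds
  have h3 : Uᴴ * P = -lowerTriangular f c := by
    have := congrArg (Uᴴ * ·) h1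
    simp only [Matrix.mul_add, ← Matrix.mul_assoc, hUU, Matrix.one_mul, Matrix.mul_zero] at this
    exact eq_neg_of_add_eq_zero_left this
  have h4 : Pᴴ * U = -(lowerTriangular f c)ᴴ := by
    rw [← conjTranspose_neg, ← h3, conjTranspose_mul, conjTranspose_conjTranspose]
  have hc0 : c = 0 := by
    refine eq_zero_of_lowerTriangular_add_conjTranspose hf ?_
    rw [h3, h4, ← neg_add, neg_eq_zero] at h2
    rwa [add_comm]
  have hv : fderiv ℝ ψ x v = 0 := by
    have h0 : lowerTriangular f c = 0 := by
      ext p q; simp [hc0, lowerTriangular]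
    rw [h0, Matrix.mul_zero, add_zero] at h1
    exact h1
  exact Prod.ext hc0 (hinj (hv.trans (map_zero _).symm))

/-- If `Φ` is a local diffeomorphism at `w`, preimages of null sets are null near `w`. -/
theorem exists_mem_nhds_measure_inter_preimage_eq_zero {W F : Type*} [NormedAddCommGroup W]
    [NormedSpace ℝ W] [FiniteDimensional ℝ W] [MeasurableSpace W] [BorelSpace W]
    [NormedAddCommGroup F] [NormedSpace ℝ F] [FiniteDimensional ℝ F] [MeasurableSpace F]
    [BorelSpace F] (μ : Measure W) [μ.IsAddHaarMeasure] (ν : Measure F) [ν.IsAddHaarMeasure]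
    (hdim : Module.finrank ℝ W = Module.finrank ℝ F) {Φ : W → F} {w : W}
    (hΦ : ContDiffAt ℝ 1 Φ w) (hinj : Function.Injective (fderiv ℝ Φ w)) {B : Set F}
    (hB : ν B = 0) : ∃ u ∈ 𝓝 w, μ (u ∩ Φ ⁻¹' B) = 0 := by
  have : CompleteSpace W := FiniteDimensional.complete ℝ W
  have : CompleteSpace F := FiniteDimensional.complete ℝ F
  let L : W ≃L[ℝ] F :=
    (LinearEquiv.ofInjectiveOfFinrankEq (fderiv ℝ Φ w : W →ₗ[ℝ] F) hinj hdim).toContinuousLinearEquiv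
  have hL : HasFDerivAt Φ (L : W →L[ℝ] F) w := (hΦ.differentiableAt one_ne_zero).hasFDerivAt
  set θ := hΦ.localInverse hL one_ne_zero with hθ
  have hleft : ∀ᶠ x in 𝓝 w, θ (Φ x) = x :=
    (hΦ.hasStrictFDerivAt' hL one_ne_zero).eventually_left_inverse
  have hdiff : ∀ᶠ y in 𝓝 (Φ w), DifferentiableAt ℝ θ y := by
    filter_upwards [(hΦ.to_localInverse hL one_ne_zero).eventually (by simp)] with y hy
    exact hy.differentiableAt one_ne_zero
  set D := {y | DifferentiableAt ℝ θ y}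
  have hnull : μ (θ '' (B ∩ D)) = 0 := by
    have hLBD : μ (L.symm '' (B ∩ D)) = 0 := by
      have h1 : (μ.map L) (B ∩ D) = 0 := by
        have : (μ.map L).IsAddHaarMeasure := L.isAddHaarMeasure_map μ
        exact Measure.absolutelyContinuous_isAddHaarMeasure (μ.map L) ν
          (measure_mono_null Set.inter_subset_left hB)
      have h2 := L.toHomeomorph.toMeasurableEquiv.map_apply (μ := μ) (B ∩ D)
      have h3 : L.symm '' (B ∩ D) = L.toHomeomorph.toMeasurableEquiv ⁻¹' (B ∩ D) :=
        L.symm.image_eq_preimage_symm _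
      rw [h3, ← h2]
      exact h1
    -- Precomposing with L gives a map from W to itself, to which the theorem on differentiable
    -- images of null sets applies.
    have h4 : θ '' (B ∩ D) = (θ ∘ L) '' (L.symm '' (B ∩ D)) := by
      rw [Set.image_image]
      simp
    rw [h4]
    refine addHaar_image_eq_zero_of_differentiableOn_of_addHaar_eq_zero μ ?_ hLBD
    rintro _ ⟨y, hy, rfl⟩
    have hy' : DifferentiableAt ℝ θ (L (L.symm y)) := by rw [L.apply_symm_apply]; exact hy.2
    exact (hy'.comp _ L.differentiableAt).differentiableWithinAt
  refine ⟨_, hleft.and (hΦ.continuousAt.eventually hdiff), measure_mono_null ?_ hnull⟩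
  rintro x ⟨⟨hx1, hx2⟩, hx3⟩
  exact ⟨Φ x, ⟨hx3, hx2⟩, hx1⟩

variable {f} in
/-- A set of unitary matrices is null if its thickening by lower triangular matrices is null in
the space of all matrices. -/
theorem isMeasureZero_of_volume_eq_zero {n : ℕ} (e : ι ≃ Fin n) (hf : Function.Injective f)
    {A : Set (Matrix.unitaryGroup (Fin n) ℂ)} {B : Set (ι → ι → ℂ)} (hB : volume B = 0)
    (hAB : ∀ g ∈ A, ∀ S : Matrix ι ι ℂ, (∀ p q, f p < f q → S p q = 0) →
      (g : Matrix (Fin n) (Fin n) ℂ).submatrix e e * S ∈ B) :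
    IsMeasureZero A := by
  intro φ hφ
  let R : (Fin n → Fin n → ℂ) →L[ℝ] (ι → ι → ℂ) := LinearMap.toContinuousLinearMap
    { toFun := fun M p q => M (e p) (e q), map_add' := fun _ _ => rfl, map_smul' := fun _ _ => rfl }
  have hR : Function.Injective R := by
    intro M N h
    funext a b
    simpa [R] using congrFun (congrFun h (e.symm a)) (e.symm b)
  set ψ₀ := fun (x : EuclideanSpace ℝ (Fin (n ^ 2))) (a b : Fin n) => (φ.symm x).1 a b with hψ₀
  set ψ : EuclideanSpace ℝ (Fin (n ^ 2)) → ι → ι → ℂ := fun x => R (ψ₀ x) with hψ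
  refine measure_null_of_locally_null _ fun x hx => ?_
  have hxt : x ∈ φ.target := by
    obtain ⟨g, hg, rfl⟩ := hx
    exact φ.map_source hg.2
  have hψ₀x : ContDiffAt ℝ 1 ψ₀ x :=
    (hφ.1.contDiffAt (φ.open_target.mem_nhds hxt)).of_le (by simp)
  have hψx : ContDiffAt ℝ 1 ψ x := R.contDiff.contDiffAt.comp x hψ₀x
  have hψinj : Function.Injective (fderiv ℝ ψ x) := by
    have h : fderiv ℝ ψ x = R.comp (fderiv ℝ ψ₀ x) :=
      (R.hasFDerivAt.comp x (hψ₀x.differentiableAt one_ne_zero).hasFDerivAt).fderiv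
    rw [h]
    exact hR.comp (hφ.2 x hxt)
  have hof : ∀ y, Matrix.of (ψ y) = (φ.symm y).1.submatrix e e := fun y => rfl
  have hψu : ∀ y, (Matrix.of (ψ y))ᴴ * Matrix.of (ψ y) = 1 := by
    intro y
    rw [hof, conjTranspose_submatrix, submatrix_mul_equiv,
      ← star_eq_conjTranspose, Matrix.mem_unitaryGroup_iff'.1 (φ.symm y).2, submatrix_one_equiv]
  have hcard : Fintype.card ι = n := by simpa using Fintype.card_congr e
  have := Measure.prod.instIsAddHaarMeasure (volume : Measure (ι → ι → ℝ))
    (volume : Measure (EuclideanSpace ℝ (Fin (n ^ 2))))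
  obtain ⟨u, hu, hu0⟩ := exists_mem_nhds_measure_inter_preimage_eq_zero
    ((volume : Measure (ι → ι → ℝ)).prod (volume : Measure (EuclideanSpace ℝ (Fin (n ^ 2)))))
    (volume : Measure (ι → ι → ℂ))
    -- The dimension count n² + n² = 2n².
    (by
      simp only [Module.finrank_prod, Module.finrank_pi_fintype, Module.finrank_self,
        finrank_euclideanSpace, Complex.finrank_real_complex, Finset.sum_const, Finset.card_univ,
        hcard, Fintype.card_fin, smul_eq_mul]
      ring)
    (contDiffAt_mul_lowerTriangular f hψx _)
    (injective_fderiv_mul_lowerTriangular hf hψx (.of_forall hψu) hψinj) hB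
  rw [nhds_prod_eq] at hu
  obtain ⟨u₁, hu₁, u₂, hu₂, hu₁₂⟩ := Filter.mem_prod_iff.1 hu
  refine ⟨_, inter_mem_nhdsWithin _ hu₂, ?_⟩
  -- The thickened chart image is a product inside a null set; its first factor is a neighbourhood,
  -- of positive measure, so the second factor is null.
  have hsub : u₁ ×ˢ (φ '' (A ∩ φ.source) ∩ u₂) ⊆ u ∩
      (fun (w : (ι → ι → ℝ) × EuclideanSpace ℝ (Fin (n ^ 2))) (p q : ι) =>
        ∑ r, ψ w.2 p r * lowerTriangular f w.1 r q) ⁻¹' B := by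
    rintro ⟨c, y⟩ ⟨hc, ⟨g, hg, rfl⟩, hy⟩
    refine ⟨hu₁₂ ⟨hc, hy⟩, ?_⟩
    have := hAB g hg.1 (lowerTriangular f c) fun p q => lowerTriangular_apply_of_lt f c
    rw [← φ.left_inv hg.2] at this
    exact this
  have h0 := measure_mono_null hsub hu0
  rw [Measure.prod_prod, mul_eq_zero] at h0
  exact h0.resolve_left (Measure.measure_pos_of_mem_nhds _ hu₁).ne'

end Chart

/-! ### Measurability of the elimination. -/

section Measurability

open MeasureTheory

noncomputable instance {p q : Type} : MeasurableSpace (Matrix p q ℂ) :=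
  inferInstanceAs (MeasurableSpace (p → q → ℂ))

instance {p q : Type} [Countable p] [Countable q] : BorelSpace (Matrix p q ℂ) :=
  inferInstanceAs (BorelSpace (p → q → ℂ))

instance {p q : Type} [Countable p] [Countable q] : SecondCountableTopology (Matrix p q ℂ) :=
  inferInstanceAs (SecondCountableTopology (p → q → ℂ))

variable {p q : Type} [Fintype p] [Fintype q] [DecidableEq q]

section

open scoped Matrix.Norms.L2Operator

theorem continuousOn_cfcSqrt :
    ContinuousOn (CFC.sqrt : Matrix q q ℂ → Matrix q q ℂ) {A | 0 ≤ A} :=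
  CFC.continuousOn_sqrt

end

theorem continuous_contraction : Continuous (contraction : Matrix p q ℂ → Matrix p q ℂ) := by
  have h1 : Continuous fun Z : Matrix p q ℂ => CFC.sqrt (1 + Zᴴ * Z) :=
    continuousOn_cfcSqrt.comp_continuous (by fun_prop)
      fun Z => (posDef_one_add_conjTranspose_mul_self Z).posSemidef.nonneg
  have h2 : ∀ Z : Matrix p q ℂ, (CFC.sqrt (1 + Zᴴ * Z)).det ≠ 0 := fun Z =>
    ((posDef_one_add_conjTranspose_mul_self Z).cfcSqrt.isUnit.map Matrix.detMonoidHom).ne_zero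
  unfold contraction
  simp only [Matrix.inv_def, Ring.inverse_eq_inv']
  exact continuous_id.matrix_mul
    ((h1.matrix_det.inv₀ h2).smul h1.matrix_adjugate)

theorem measurable_matrix_inv : Measurable (fun A : Matrix q q ℂ => A⁻¹) := by
  simp only [Matrix.inv_def, Ring.inverse_eq_inv']
  have h1 : Measurable fun A : Matrix q q ℂ => A.det := continuous_id.matrix_det.measurable
  have h2 : Continuous fun A : Matrix q q ℂ => A.adjugate := continuous_id.matrix_adjugate
  have h3 : Continuous fun x : ℂ × Matrix q q ℂ => x.1 • x.2 := by fun_prop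
  exact h3.measurable.comp (h1.inv.prodMk h2.measurable)

/-- Parametrizing the ball by Z keeps the arguments of the square roots positive semidefinite, where
the square root is continuous. -/
theorem continuous_extendedW_contraction {m : ℕ} (k : Fin m → ℕ) (j : Fin m) :
    Continuous fun Z => extendedW k j (contraction Z) := by
  unfold extendedW blockW
  simp only [reindex_apply]
  refine Continuous.matrix_submatrix (Continuous.matrix_fromBlocks (Continuous.matrix_fromBlocks
    ?_ continuous_contraction continuous_contraction.matrix_conjTranspose.neg ?_)
    continuous_const continuous_const continuous_const) _ _
  · exact continuousOn_cfcSqrt.comp_continuous (continuous_const.sub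
      (continuous_contraction.matrix_mul continuous_contraction.matrix_conjTranspose))
      fun Z => (posSemidef_one_sub_mul_conjTranspose (contraction_mem_matrixBall Z)).nonneg
  · exact continuousOn_cfcSqrt.comp_continuous (continuous_const.sub
      (continuous_contraction.matrix_conjTranspose.matrix_mul continuous_contraction))
      fun Z => (Matrix.PosDef.posSemidef (contraction_mem_matrixBall Z)).nonneg

theorem measurable_peel {m : ℕ} (k : Fin m → ℕ) (j : Fin m) : Measurable (peel k j) := by
  have h1 : Continuous fun x : Matrix (BlocksBefore k j) (Fin (k j)) ℂ ×
      Matrix (BlockIndex k) (BlockIndex k) ℂ => (extendedW k j (contraction x.1))ᴴ * x.2 :=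
    ((continuous_extendedW_contraction k j).comp continuous_fst).matrix_conjTranspose.matrix_mul
      continuous_snd
  have h2 : Continuous fun x : Matrix (BlocksBefore k j) (Fin (k j)) ℂ ×
      Matrix (Fin (k j)) (Fin (k j)) ℂ => x.1 * x.2 := continuous_fst.matrix_mul continuous_snd
  have h3 : Continuous (upperBlock k j) := continuous_id.matrix_submatrix _ _
  have h4 : Continuous (diagBlock k j) := continuous_id.matrix_submatrix _ _
  have h5 : Measurable fun Y => (diagBlock k j Y)⁻¹ := measurable_matrix_inv.comp h4.measurable
  have h6 : Measurable fun Y => upperBlock k j Y * (diagBlock k j Y)⁻¹ :=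
    h2.measurable.comp (h3.measurable.prodMk h5)
  have h7 := h1.measurable.comp (h6.prodMk measurable_id)
  exact h7

theorem measurable_columnResidual {m : ℕ} (k : Fin (m + 1) → ℕ) (j : Fin (m + 1)) :
    Measurable fun M => columnResidual k M j := by
  induction j using Fin.reverseInduction with
  | last => simpa using measurable_id'
  | cast i ih =>
    simp only [columnResidual_castSucc]
    exact (measurable_peel k i.succ).comp ih

end Measurability

/-! ### Degenerate matrices form a null set. -/

section NullSet

open MeasureTheory

/-- Translating v by t Rᴴ adds t I to the matrix, so along each such complex line the determinant is
a characteristic polynomial in t, with finitely many zeros. -/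
theorem ae_det_add_mul_ne_zero {p q : Type} [Fintype p] [Fintype q] [DecidableEq q]
    (C : Matrix q q ℂ) {R : Matrix q p ℂ} (hR : R * Rᴴ = 1) :
    ∀ᵐ v : p → q → ℂ, (C + R * Matrix.of v).det ≠ 0 := by
  have hcont : Continuous fun v : p → q → ℂ => (C + R * Matrix.of v).det :=
    (continuous_const.add (continuous_const.matrix_mul continuous_id)).matrix_det
  let L : ℂ →ₗ[ℂ] (p → q → ℂ) := LinearMap.toSpanSingleton ℂ _ fun a b => Rᴴ a b
  refine ae_mem_of_ae_add_linearMap_mem L volume volume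
    (s := {v | (C + R * Matrix.of v).det ≠ 0})
    (hcont.measurable (measurableSet_singleton 0).compl) fun v => ?_
  have hfin : {t : ℂ | (-(C + R * Matrix.of v)).charpoly.IsRoot t}.Finite :=
    Polynomial.finite_setOfPred_isRoot (Matrix.charpoly_monic _).ne_zero
  refine (measure_mono_null (fun t ht => ?_) (hfin.measure_zero volume) : volume _ = 0)
  by_contra hne
  refine ht fun h0 => hne ?_
  have h1 : Matrix.of (v + L t) = Matrix.of v + t • Rᴴ := rfl
  rw [h1, Matrix.mul_add, Matrix.mul_smul, hR, ← add_assoc] at h0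
  change Polynomial.eval t _ = 0
  rw [Matrix.eval_charpoly, sub_neg_eq_add, add_comm, scalar_apply,
    ← Matrix.smul_one_eq_diagonal]
  exact h0

theorem ae_det_columnResidual_ne_zero {m : ℕ} (k : Fin (m + 1) → ℕ) (j : Fin (m + 1)) :
    ∀ᵐ M : BlockIndex k → BlockIndex k → ℂ,
      (diagBlock k j (columnResidual k (Matrix.of M) j)).det ≠ 0 := by
  have hd : Continuous fun Y => (diagBlock k j Y).det :=
    (continuous_id.matrix_submatrix _ _).matrix_det
  have hmeas : Measurable fun M : BlockIndex k → BlockIndex k → ℂ =>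
      (diagBlock k j (columnResidual k (Matrix.of M) j)).det :=
    hd.measurable.comp (measurable_columnResidual k j)
  let L : (BlockIndex k → Fin (k j) → ℂ) →ₗ[ℂ] (BlockIndex k → BlockIndex k → ℂ) :=
    { toFun := fun v p q => ∑ b, if q = ⟨j, b⟩ then v p b else 0
      map_add' := fun v w => by
        funext p q
        simp only [Pi.add_apply, ← Finset.sum_add_distrib]
        exact Finset.sum_congr rfl fun b _ => by split_ifs <;> simp
      map_smul' := fun t v => by
        funext p q
        simp [Finset.mul_sum] }
  have hLj : ∀ v p b, L v p ⟨j, b⟩ = v p b := fun v p b => by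
    simp [L]
  have hL0 : ∀ v p (q : BlockIndex k), j < q.1 → L v p q = 0 := fun v p q hq => by
    change ∑ b, (if q = ⟨j, b⟩ then v p b else 0) = 0
    exact Finset.sum_eq_zero fun b _ => if_neg fun e : q = ⟨j, b⟩ => hq.ne (congrArg Sigma.fst e).symm
  refine ae_mem_of_ae_add_linearMap_mem L volume volume
    (hmeas (measurableSet_singleton 0).compl) fun M => ?_
  -- Varying block column j alone leaves Q unchanged, so the diagonal block is affine in that
  -- column.
  obtain ⟨Q, hQ, hres⟩ := exists_columnResidual_eq_mul (Matrix.of M) j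
  set R : Matrix (Fin (k j)) (BlockIndex k) ℂ := Q.submatrix (fun a => ⟨j, a⟩) id with hR
  have hRR : R * Rᴴ = 1 := by
    rw [hR, conjTranspose_submatrix, ← submatrix_mul _ _ _ _ _ Function.bijective_id, hQ]
    ext a b
    simp [Matrix.one_apply]
  filter_upwards [ae_det_add_mul_ne_zero (diagBlock k j (Q * Matrix.of M)) hRR] with v hv
  change (diagBlock k j (columnResidual k (Matrix.of (M + L v)) j)).det ≠ 0
  rw [hres _ fun p q hq => by simp [hL0 v p q hq]]
  have h : diagBlock k j (Q * Matrix.of (M + L v)) =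
      diagBlock k j (Q * Matrix.of M) + R * Matrix.of v := by
    ext a b
    simp [diagBlock, Matrix.mul_apply, hR, mul_add, Finset.sum_add_distrib, hLj]
  rwa [h]

theorem volume_setOf_not_blockNondegenerate {m : ℕ} (k : Fin (m + 1) → ℕ) :
    volume {M : BlockIndex k → BlockIndex k → ℂ | ¬ BlockNondegenerate k (Matrix.of M)} = 0 := by
  have h : ∀ᵐ M : BlockIndex k → BlockIndex k → ℂ, BlockNondegenerate k (Matrix.of M) := by
    filter_upwards [ae_all_iff.2 fun i : Fin m => ae_det_columnResidual_ne_zero k i.succ]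
      with M hM i
    exact isUnit_iff_ne_zero.2 (hM i)
  exact h

end NullSet

theorem mainTheorem3 (n m : ℕ) (k : Fin (m + 1) → ℕ) (hn : ∑ j, k j = n) :
    IsMeasureZero {g : Matrix.unitaryGroup (Fin n) ℂ |
      ¬ ∃! P : BallParameters k × ((j : Fin (m + 1)) → Matrix.unitaryGroup (Fin (k j)) ℂ),
        (g : Matrix (Fin n) (Fin n) ℂ) =
          Matrix.reindex (blockNumbering k hn) (blockNumbering k hn)
            (cosetProduct k P.1 *
              Matrix.blockDiagonal' fun j => (P.2 j : Matrix (Fin (k j)) (Fin (k j)) ℂ))} := by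
  set e := blockNumbering k hn
  -- The lexicographic order refines the order of the blocks, so lower triangular matrices are block
  -- lower triangular.
  refine isMeasureZero_of_volume_eq_zero (f := (toLex : BlockIndex k → Σₗ j, Fin (k j))) e
    toLex.injective (volume_setOf_not_blockNondegenerate k) fun g hg S hS hnd => hg ?_
  have hS' : ∀ p q : BlockIndex k, p.1 < q.1 → S p q = 0 := fun p q hpq =>
    hS p q (Sigma.Lex.left _ _ hpq)
  have hgu : (g.1.submatrix e e)ᴴ * g.1.submatrix e e = 1 := by
    rw [conjTranspose_submatrix, submatrix_mul_equiv, ← star_eq_conjTranspose,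
      Matrix.mem_unitaryGroup_iff'.1 g.2, submatrix_one_equiv]
  have h := existsUnique_cosetProduct_of_blockNondegenerate hgu (blockNondegenerate_of_mul hS' hnd)
  refine (existsUnique_congr fun P => ?_).1 h
  rw [← (reindex e e).symm.injective.eq_iff, Equiv.symm_apply_apply]
  rfl
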